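/- Let $\mathcal X,\mathcal Y$ be Polish spaces with Borel $\sigma$-algebras $\mathcal B(\mathcal X)$, $\mathcal B(\mathcal Y)$, let $(Y_t)_{t\in\mathbb Z}$ be a strictly stationary $\mathcal Y$-valued process, and let $Q:\mathcal X\times\mathcal Y\times\mathcal B(\mathcal X)\to[0,1]$ be a parametrized family of transition kernels ($Q(\cdot,\cdot,A)$ is measurable for each $A$ and $Q(x,y,\cdot)$ is a probability for all $x,y$). An $\mathcal X$-valued process $(X_t)_{t\in\mathbb N}$ is a Markov chain in the random environment $Y$ with kernel $Q$ if $$P\big(X_{t+1}\in A\mid \sigma(Y_j,\ j\in\mathbb Z;\ X_i,\ 0\le i\le t)\big)=Q(X_t,Y_t,A)\quad\text{a.s.},\qquad t\in\mathbb N,\ A\in\mathcal B(\mathcal X).$$ Let $(\mathcal X_n)_{n\in\mathbb N}$ and $(\mathcal Y_n)_{n\in\mathbb N}$ be non-decreasing sequences of Borel sets in $\mathcal X$ and $\mathcal Y$ with $\mathcal X_0\ne\emptyset$, $\mathcal Y_0\neq\emptyset$. Let $\mathfrak M_b$ be the set of probability laws $\mu$ on $\mathcal X\times\mathcal Y^{\mathbb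 Z}$ whose second marginal is the law of $(Y_k)_{k\in\mathbb Z}$ and for which the chain in the random environment started with $\mathcal L(X_0,(Y_k)_{k\in\mathbb Z})=\mu$ satisfies $\sup_{t\in\mathbb N}P(X_t\notin\mathcal X_n)\to0$ as $n\to\infty$. For probabilities $\mu,\nu$ write $\|\mu-\nu\|_{TV}=\sup_{|\phi|\le1}|\int\phi\,d\mu-\int\phi\,d\nu|$, where the supremum is over measurable $\phi$. Assume that $P(Y_0\notin\mathcal Y_n)\to0$ as $n\to\infty$, and that there are a non-increasing sequence $\alpha_n\in(0,1]$ and probability measures $\nu_n$ on $\mathcal B(\mathcal X)$ such that $Q(x,y,A)\ge\alpha_n\nu_n(A)$ for all $n\in\mathbb N$, $x\in\mathcal X_n$, $y\in\mathcal Y_n$, $A\in\mathcal B(\mathcal X)$. Assume also $\mathfrak M_b\ne\emptyset$. Then there is a probability $\mu_\sharp$ on $\mathcal B(\mathcal X\times\mathcal Y^{\mathbb Z})$ such that: 1. for every Markov chain $X$ in the random environment $Y$ with kernel $Q$ and $\mathcal L(X_0,(Y_k)_{k\in\mathbb Z})\in\mathfrak M_b$, $$\|\mathcal L(X_t,(Y_{t+k})_{k\in\mathbb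 Z})-\mu_\sharp\|_{TV}\to0,\qquad t\to\infty$$ (in particular $\mu_\sharp$ does not depend on the choice of the initial law in $\mathfrak M_b$); 2. if $X,X'$ are two such chains with initial laws in $\mathfrak M_b$, then $\|\mathcal L(X_t,(Y_{t+k})_{k\in\mathbb Z})-\mathcal L(X'_t,(Y_{t+k})_{k\in\mathbb Z})\|_{TV}\to0$ as $t\to\infty$; 3. $\mu_\sharp$ is invariant: if $X$ is such a chain with $\mathcal L(X_0,(Y_k)_{k\in\mathbb Z})=\mu_\sharp$, then $\mathcal L(X_t,(Y_{t+k})_{k\in\mathbb Z})=\mu_\sharp$ for every $t\in\mathbb N$. -/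

import Mathlib

open MeasureTheory ProbabilityTheory Filter Topology

/-- Total variation distance `‖μ - ν‖_TV`: the supremum of `|∫ φ dμ - ∫ φ dν|` over measurable
real functions `φ` with `|φ| ≤ 1`. It is used for probability measures only, where the supremum is
over a set of reals bounded by `2`. -/
noncomputable def tvDist {Z : Type*} [MeasurableSpace Z] (μ ν : Measure Z) : ℝ :=
  ⨆ φ : {φ : Z → ℝ // Measurable φ ∧ ∀ z, |φ z| ≤ 1}, |(∫ z, φ.1 z ∂μ) - ∫ z, φ.1 z ∂ν|

/-- A law on two-sided sequences is (strict sense) stationary if it is invariant under all time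
shifts. -/
def IsStationaryLaw {S : Type*} [MeasurableSpace S] (π : Measure (ℤ → S)) : Prop :=
  ∀ s : ℤ, π.map (fun y k => y (s + k)) = π

/-- The sigma-algebra `σ(Y_j, j ∈ ℤ; X_i, 0 ≤ i ≤ t)`. -/
abbrev pastSigma {Ω E S : Type*} [MeasurableSpace E] [MeasurableSpace S]
    (X : ℕ → Ω → E) (Y : ℤ → Ω → S) (t : ℕ) : MeasurableSpace Ω :=
  (⨆ j : ℤ, MeasurableSpace.comap (Y j) inferInstance) ⊔
    (⨆ (i : ℕ) (_ : i ≤ t), MeasurableSpace.comap (X i) inferInstance)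

/-- `X` is a Markov chain in the random environment `Y` with transition kernel `Q`, under `P`:
`P(X_{t+1} ∈ A | σ(Y_j, j ∈ ℤ; X_i, 0 ≤ i ≤ t)) = Q(X_t, Y_t, A)` almost surely. -/
structure IsMCRE {Ω E S : Type*} [MeasurableSpace Ω] [MeasurableSpace E] [MeasurableSpace S]
    (P : Measure Ω) (Q : Kernel (E × S) E) (X : ℕ → Ω → E) (Y : ℤ → Ω → S) : Prop where
  measurable_chain : ∀ t, Measurable (X t)
  measurable_env : ∀ k, Measurable (Y k)
  condProb_eq : ∀ (t : ℕ) (A : Set E), MeasurableSet A →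
    P[(X (t + 1) ⁻¹' A).indicator (fun _ => (1 : ℝ)) | pastSigma X Y t]
      =ᵐ[P] fun ω => (Q (X t ω, Y t ω)).real A

/-- The joint law of `(X_t, (Y_{t+k})_{k ∈ ℤ})`. -/
noncomputable def jointLaw {Ω E S : Type*} [MeasurableSpace Ω] [MeasurableSpace E]
    [MeasurableSpace S] (P : Measure Ω) (X : ℕ → Ω → E) (Y : ℤ → Ω → S) (t : ℕ) :
    Measure (E × (ℤ → S)) :=
  P.map (fun ω => (X t ω, fun k : ℤ => Y (t + k) ω))

/-- The class of initial laws `μ` on `E × S^ℤ` with second marginal `π` (the law of the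
environment) such that the chain in random environment started from `μ` satisfies
`sup_t P(X_t ∉ 𝒳_n) → 0`. The chain is realized as the coordinate process under a probability `R`
on path space `E^ℕ × S^ℤ`; the kernel and `μ` determine `R` uniquely. -/
def tightInitialLaws {E S : Type*} [MeasurableSpace E] [MeasurableSpace S]
    (π : Measure (ℤ → S)) (Q : Kernel (E × S) E) (Xset : ℕ → Set E) :
    Set (Measure (E × (ℤ → S))) :=
  {μ | IsProbabilityMeasure μ ∧ μ.map Prod.snd = π ∧
    ∃ R : Measure ((ℕ → E) × (ℤ → S)), IsProbabilityMeasure R ∧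
      IsMCRE R Q (fun t ω => ω.1 t) (fun k ω => ω.2 k) ∧
      jointLaw R (fun t ω => ω.1 t) (fun k ω => ω.2 k) 0 = μ ∧
      Tendsto (fun n => ⨆ t : ℕ, R {ω | ω.1 t ∉ Xset n}) atTop (𝓝 0)}

/-!
The pair `Z_t = (X_t, (Y_{t+k})_k)` is a Markov chain on `E × S^ℤ` with kernel `envKernel Q`: the
first coordinate moves by `Q(x, y_0, ·)` and the environment is shifted deterministically
(`IsMCRE.jointLaw_succ`). It therefore suffices to study the iterates `μ_t` of this kernel.

Two admissible initial laws have the same second marginal, so their chains can be coupled with a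
common environment. The coupling is carried out on the level of measures. At each time one has
`μ_t = c + a` and `μ'_t = c + b`, where `c` is the merged part and `a`, `b` have the same second
marginal. On `G = Xset n × {y | y 0 ∈ Yset n}` the kernel dominates `α ν ⊗ δ_{shift y}`, which
depends on the environment only, so `a` and `b` produce a new common part, of mass at least
`α (|a| - a Gᶜ - b Gᶜ)` (`exists_common_part_comp`). Since `a ≤ μ_t`, `b ≤ μ'_t` and both laws
charge `Gᶜ` with mass at most `ε`, uniformly in time, `|a|` is at most
`(1 - α) ^ t + 2 ε` (`tvDist_le_of_minorization`), and `ε` is small for large `n`.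

The rate depends only on the uniform tightness bounds, so it also applies to a chain and its
delayed copies (`exists_forall_tvDist_le`). Hence the laws `μ_t` form a Cauchy sequence in total
variation, and completeness (`exists_tendsto_tvDist_of_cauchy`) gives the limit, which is invariant
because the kernel is a contraction in total variation (`comp_eq_self_of_tendsto_tvDist`).
-/

/-! ### Total variation distance -/

section TotalVariation

variable {Z : Type*} [MeasurableSpace Z]

lemma abs_integral_le_measureReal_univ (μ : Measure Z) [IsFiniteMeasure μ] {φ : Z → ℝ}
    (hφ : ∀ z, |φ z| ≤ 1) : |∫ z, φ z ∂μ| ≤ μ.real Set.univ := by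
  simpa using norm_integral_le_of_norm_le_const (μ := μ) (f := φ) (C := 1) (ae_of_all _ hφ)

lemma integrable_of_abs_le_one (μ : Measure Z) [IsFiniteMeasure μ] {φ : Z → ℝ}
    (hφm : Measurable φ) (hφ : ∀ z, |φ z| ≤ 1) : Integrable φ μ :=
  Integrable.of_bound hφm.aestronglyMeasurable 1 (ae_of_all _ hφ)

lemma tvDist_le {μ ν : Measure Z} {r : ℝ}
    (h : ∀ φ : Z → ℝ, Measurable φ → (∀ z, |φ z| ≤ 1) → |(∫ z, φ z ∂μ) - ∫ z, φ z ∂ν| ≤ r) :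
    tvDist μ ν ≤ r := by
  have : Nonempty {φ : Z → ℝ // Measurable φ ∧ ∀ z, |φ z| ≤ 1} :=
    ⟨⟨fun _ => 0, measurable_const, by simp⟩⟩
  exact ciSup_le fun φ => h φ.1 φ.2.1 φ.2.2

lemma tvDist_nonneg (μ ν : Measure Z) : 0 ≤ tvDist μ ν :=
  Real.iSup_nonneg fun _ => abs_nonneg _

lemma abs_integral_sub_le_tvDist (μ ν : Measure Z) [IsFiniteMeasure μ] [IsFiniteMeasure ν]
    {φ : Z → ℝ} (hφm : Measurable φ) (hφ : ∀ z, |φ z| ≤ 1) :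
    |(∫ z, φ z ∂μ) - ∫ z, φ z ∂ν| ≤ tvDist μ ν := by
  refine le_ciSup (f := fun φ : {φ : Z → ℝ // Measurable φ ∧ ∀ z, |φ z| ≤ 1} =>
    |(∫ z, φ.1 z ∂μ) - ∫ z, φ.1 z ∂ν|) ⟨μ.real Set.univ + ν.real Set.univ, ?_⟩ ⟨φ, hφm, hφ⟩
  rintro _ ⟨ψ, rfl⟩
  exact (abs_sub _ _).trans (add_le_add (abs_integral_le_measureReal_univ μ ψ.2.2)
    (abs_integral_le_measureReal_univ ν ψ.2.2))

lemma tvDist_triangle (μ ν ρ : Measure Z) [IsFiniteMeasure μ] [IsFiniteMeasure ν]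
    [IsFiniteMeasure ρ] : tvDist μ ρ ≤ tvDist μ ν + tvDist ν ρ :=
  tvDist_le fun _ hφm hφ => (abs_sub_le _ _ _).trans (add_le_add
    (abs_integral_sub_le_tvDist μ ν hφm hφ) (abs_integral_sub_le_tvDist ν ρ hφm hφ))

lemma abs_measureReal_sub_le_tvDist (μ ν : Measure Z) [IsFiniteMeasure μ] [IsFiniteMeasure ν]
    {A : Set Z} (hA : MeasurableSet A) : |μ.real A - ν.real A| ≤ tvDist μ ν := by
  have h := abs_integral_sub_le_tvDist μ ν (φ := A.indicator fun _ => (1 : ℝ))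
    (measurable_const.indicator hA) fun z => by
      by_cases hz : z ∈ A <;> simp [hz]
  simpa [integral_indicator hA] using h

/-- Two finite measures with a common part `c` are no further apart than the total mass of what
remains. -/
lemma tvDist_add_le (c a b : Measure Z) [IsFiniteMeasure c] [IsFiniteMeasure a]
    [IsFiniteMeasure b] : tvDist (c + a) (c + b) ≤ a.real Set.univ + b.real Set.univ := by
  refine tvDist_le fun φ hφm hφ => ?_
  rw [integral_add_measure (integrable_of_abs_le_one _ hφm hφ)
      (integrable_of_abs_le_one _ hφm hφ), integral_add_measure
      (integrable_of_abs_le_one _ hφm hφ) (integrable_of_abs_le_one _ hφm hφ),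
    add_sub_add_left_eq_sub]
  exact (abs_sub _ _).trans (add_le_add (abs_integral_le_measureReal_univ a hφ)
    (abs_integral_le_measureReal_univ b hφ))

/-- A bound on the difference of two probability measures, uniform over measurable sets, bounds
their total variation distance up to a factor `2`. This is the layer-cake formula for
`(1 + φ) / 2`, which takes values in `[0, 1]`. -/
lemma tvDist_le_of_forall_measurableSet (μ ν : Measure Z) [IsProbabilityMeasure μ]
    [IsProbabilityMeasure ν] {r : ℝ}
    (h : ∀ A, MeasurableSet A → |μ.real A - ν.real A| ≤ r) : tvDist μ ν ≤ 2 * r := by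
  refine tvDist_le fun φ hφm hφ => ?_
  set f : Z → ℝ := fun z => (1 + φ z) / 2 with hf
  have hfm : Measurable f := by fun_prop
  have hf0 : ∀ z, 0 ≤ f z := fun z => by have := abs_le.1 (hφ z); simp only [hf]; linarith
  have hf1 : ∀ z, f z ≤ 1 := fun z => by have := abs_le.1 (hφ z); simp only [hf]; linarith
  have hfabs : ∀ z, |f z| ≤ 1 := fun z => abs_le.2 ⟨by linarith [hf0 z], hf1 z⟩
  have layer : ∀ (ρ : Measure Z) [IsProbabilityMeasure ρ],
      ∫ z, f z ∂ρ = ∫ t in Set.Ioc (0 : ℝ) 1, ρ.real {z | t ≤ f z} := fun ρ _ =>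
    (integrable_of_abs_le_one ρ hfm hfabs).integral_eq_integral_Ioc_meas_le (ae_of_all _ hf0)
      (ae_of_all _ hf1)
  have hint : ∀ (ρ : Measure Z) [IsProbabilityMeasure ρ],
      Integrable (fun t : ℝ => ρ.real {z | t ≤ f z}) (volume.restrict (Set.Ioc (0 : ℝ) 1)) := by
    intro ρ _
    have hanti : Antitone fun t : ℝ => ρ.real {z | t ≤ f z} := fun s t hst =>
      measureReal_mono fun z (hz : t ≤ f z) => hst.trans hz
    exact Integrable.of_bound hanti.measurable.aestronglyMeasurable 1
      (ae_of_all _ fun t => by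
        rw [Real.norm_of_nonneg measureReal_nonneg]; exact measureReal_le_one)
  have key : |(∫ z, f z ∂μ) - ∫ z, f z ∂ν| ≤ r := by
    rw [layer μ, layer ν, ← integral_sub (hint μ) (hint ν)]
    simpa using norm_integral_le_of_norm_le_const
      (μ := (volume : Measure ℝ).restrict (Set.Ioc (0 : ℝ) 1))
      (f := fun t => μ.real {z | t ≤ f z} - ν.real {z | t ≤ f z}) (C := r)
      (ae_of_all _ fun t => h _ (measurableSet_le measurable_const hfm))
  have hφf : ∀ (ρ : Measure Z) [IsProbabilityMeasure ρ],
      ∫ z, φ z ∂ρ = 2 * (∫ z, f z ∂ρ) - 1 := by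
    intro ρ _
    have : ∀ z, φ z = 2 * f z - 1 := fun z => by simp only [hf]; ring
    simp_rw [this]
    rw [integral_sub ((integrable_of_abs_le_one ρ hfm hfabs).const_mul 2) (integrable_const _),
      integral_const_mul]
    simp
  rw [hφf μ, hφf ν, show ∀ x y : ℝ, 2 * x - 1 - (2 * y - 1) = 2 * (x - y) by intros; ring,
    abs_mul, abs_two]
  linarith

/-- Completeness of the space of probability measures in total variation. The limit is first
obtained on each measurable set; uniformity of the convergence makes it countably additive. -/
lemma exists_tendsto_tvDist_of_cauchy (μ : ℕ → Measure Z) [∀ t, IsProbabilityMeasure (μ t)]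
    (h : ∀ δ > 0, ∃ T, ∀ t ≥ T, ∀ s, tvDist (μ t) (μ (t + s)) ≤ δ) :
    ∃ ρ : Measure Z, IsProbabilityMeasure ρ ∧
      Tendsto (fun t => tvDist (μ t) ρ) atTop (𝓝 0) := by
  have hset : ∀ δ > 0, ∃ T, ∀ t ≥ T, ∀ s, ∀ A, MeasurableSet A →
      |(μ t).real A - (μ (t + s)).real A| ≤ δ := fun δ hδ => by
    obtain ⟨T, hT⟩ := h δ hδ
    exact ⟨T, fun t ht s A hA => (abs_measureReal_sub_le_tvDist _ _ hA).trans (hT t ht s)⟩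
  have hlim : ∀ A, MeasurableSet A → ∃ l, Tendsto (fun t => (μ t).real A) atTop (𝓝 l) := by
    intro A hA
    refine cauchySeq_tendsto_of_complete (Metric.cauchySeq_iff'.2 fun δ hδ => ?_)
    obtain ⟨T, hT⟩ := hset (δ / 2) (half_pos hδ)
    refine ⟨T, fun t ht => ?_⟩
    have := hT T le_rfl (t - T) A hA
    rw [Nat.add_sub_cancel' ht, abs_sub_comm] at this
    rw [Real.dist_eq]
    linarith
  choose L hL using hlim
  have hunif : ∀ δ > 0, ∃ T, ∀ t ≥ T, ∀ A (hA : MeasurableSet A),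
      |(μ t).real A - L A hA| ≤ δ := fun δ hδ => by
    obtain ⟨T, hT⟩ := hset δ hδ
    refine ⟨T, fun t ht A hA => ?_⟩
    have hlim' : Tendsto (fun s => |(μ t).real A - (μ (t + s)).real A|) atTop
        (𝓝 |(μ t).real A - L A hA|) :=
      (tendsto_const_nhds.sub ((hL A hA).comp (tendsto_add_atTop_nat t |>.congr
        fun s => add_comm s t))).abs
    exact le_of_tendsto' hlim' fun s => hT t ht s A hA
  have hL0 : ∀ A hA, 0 ≤ L A hA := fun A hA => ge_of_tendsto' (hL A hA) fun _ => measureReal_nonneg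
  have hLempty : L ∅ MeasurableSet.empty = 0 :=
    tendsto_nhds_unique (hL ∅ MeasurableSet.empty) (by simp)
  have hsum : ∀ (f : ℕ → Set Z) (hf : ∀ i, MeasurableSet (f i)),
      Pairwise (Function.onFun Disjoint f) →
      HasSum (fun i => L (f i) (hf i)) (L (⋃ i, f i) (MeasurableSet.iUnion hf)) := by
    intro f hf hd
    have hpart : ∀ s : Finset ℕ, L (⋃ i ∈ s, f i) (s.measurableSet_biUnion fun i _ => hf i)
        = ∑ i ∈ s, L (f i) (hf i) := by
      intro s
      refine tendsto_nhds_unique (hL _ _) ?_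
      refine (tendsto_finsetSum s fun i _ => hL (f i) (hf i)).congr fun t => ?_
      exact (measureReal_biUnion_finset (fun i _ j _ hij => hd hij) fun i _ => hf i).symm
    have hU : TendstoUniformly (fun t (s : Finset ℕ) => (μ t).real (⋃ i ∈ s, f i))
        (fun s => ∑ i ∈ s, L (f i) (hf i)) atTop := by
      rw [Metric.tendstoUniformly_iff]
      intro δ hδ
      obtain ⟨T, hT⟩ := hunif (δ / 2) (half_pos hδ)
      filter_upwards [eventually_ge_atTop T] with t ht s
      have := hT t ht _ (s.measurableSet_biUnion fun i _ => hf i)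
      rw [← hpart, dist_comm, Real.dist_eq]
      linarith
    refine hU.tendsto_of_eventually_tendsto (Eventually.of_forall fun t => ?_)
      (hL (⋃ i, f i) (MeasurableSet.iUnion hf))
    have hμ : HasSum (fun i => (μ t).real (f i)) ((μ t).real (⋃ i, f i)) := by
      have hne : ∑' i, μ t (f i) ≠ ⊤ := by
        rw [← measure_iUnion hd hf]; exact measure_ne_top _ _
      simp only [measureReal_def]
      rw [measure_iUnion hd hf, ENNReal.tsum_toReal_eq fun i => measure_ne_top _ _]
      exact ENNReal.hasSum_toReal hne
    refine Tendsto.congr (fun s => ?_) hμ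
    exact (measureReal_biUnion_finset (fun i _ j _ hij => hd hij) fun i _ => hf i).symm
  let ρ : Measure Z := Measure.ofMeasurable (fun A hA => ENNReal.ofReal (L A hA))
    (by simp [hLempty]) fun f hf hd => by
      rw [← (hsum f hf hd).tsum_eq, ENNReal.ofReal_tsum_of_nonneg (fun i => hL0 _ _)
        (hsum f hf hd).summable]
  have hρ : ∀ A (hA : MeasurableSet A), ρ A = ENNReal.ofReal (L A hA) := fun A hA =>
    Measure.ofMeasurable_apply A hA
  have hρreal : ∀ A (hA : MeasurableSet A), ρ.real A = L A hA := fun A hA => by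
    rw [measureReal_def, hρ A hA, ENNReal.toReal_ofReal (hL0 A hA)]
  have hprob : IsProbabilityMeasure ρ := ⟨by
    have h1 : L Set.univ MeasurableSet.univ = 1 :=
      tendsto_nhds_unique (hL _ MeasurableSet.univ) (by simp)
    rw [hρ _ MeasurableSet.univ, h1, ENNReal.ofReal_one]⟩
  refine ⟨ρ, hprob, Metric.tendsto_atTop.2 fun δ hδ => ?_⟩
  obtain ⟨T, hT⟩ := hunif (δ / 4) (by positivity)
  refine ⟨T, fun t ht => ?_⟩
  have := tvDist_le_of_forall_measurableSet (μ t) ρ (r := δ / 4) fun A hA => by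
    rw [hρreal A hA]; exact hT t ht A hA
  rw [Real.dist_eq, sub_zero, abs_of_nonneg (tvDist_nonneg _ _)]
  linarith

lemma tendsto_tvDist_of_exists_le {μ ν : ℕ → Measure Z}
    (h : ∀ δ > 0, ∃ T, ∀ t ≥ T, ∀ s, tvDist (μ t) (ν (t + s)) ≤ δ) :
    Tendsto (fun t => tvDist (μ t) (ν t)) atTop (𝓝 0) := by
  refine Metric.tendsto_atTop.2 fun δ hδ => ?_
  obtain ⟨T, hT⟩ := h (δ / 2) (half_pos hδ)
  refine ⟨T, fun t ht => ?_⟩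
  rw [Real.dist_eq, sub_zero, abs_of_nonneg (tvDist_nonneg _ _)]
  exact (hT t ht 0).trans_lt (half_lt_self hδ)

end TotalVariation

/-! ### One step of the coupling -/

section Contraction

/-- If `a₁ + a₂ = b₁ + b₂`, then `a₁` and `b₁` have a common part whose mass falls short of the
total by at most the masses of `a₂` and `b₂`: on each half of a Hahn decomposition take the
smaller of `a₁` and `b₁`. -/
lemma exists_common_part {T : Type*} [MeasurableSpace T] (a₁ a₂ b₁ b₂ : Measure T)
    [IsFiniteMeasure a₁] [IsFiniteMeasure a₂] [IsFiniteMeasure b₁] [IsFiniteMeasure b₂]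
    (h : a₁ + a₂ = b₁ + b₂) :
    ∃ m : Measure T, m ≤ a₁ ∧ m ≤ b₁ ∧
      a₁.real Set.univ ≤ m.real Set.univ + b₂.real Set.univ := by
  obtain ⟨s, hs⟩ := exists_isHahnDecomposition a₁ b₁
  have hsm := hs.measurableSet
  refine ⟨a₁.restrict s + b₁.restrict sᶜ, ?_, ?_, ?_⟩
  · calc _ ≤ a₁.restrict s + a₁.restrict sᶜ := add_le_add_right hs.ge_on_compl _
      _ = a₁ := Measure.restrict_add_restrict_compl hsm
  · calc _ ≤ b₁.restrict s + b₁.restrict sᶜ := add_le_add_left hs.le_on _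
      _ = b₁ := Measure.restrict_add_restrict_compl hsm
  · have h1 : a₁.real sᶜ ≤ b₁.real sᶜ + b₂.real sᶜ := by
      rw [← measureReal_add_apply, ← h, measureReal_add_apply]
      linarith [measureReal_nonneg (μ := a₂) (s := sᶜ)]
    have h2 : b₂.real sᶜ ≤ b₂.real Set.univ := measureReal_mono (Set.subset_univ _)
    have h3 := measureReal_add_measureReal_compl (μ := a₁) hsm
    rw [measureReal_add_apply]
    simp only [measureReal_restrict_apply_univ]
    linarith

variable {E T : Type*} [MeasurableSpace E] [MeasurableSpace T]
  {K : Kernel (E × T) (E × T)} {θ : T → T}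

lemma map_snd_comp_of_skew (hθ : Measurable θ)
    (hK : ∀ z, (K z).map Prod.snd = Measure.dirac (θ z.2)) (a : Measure (E × T)) :
    (K ∘ₘ a).map Prod.snd = (a.map Prod.snd).map θ := by
  ext B hB
  have hfun : ∀ z, K z (Prod.snd ⁻¹' B) = ((fun z : E × T => θ z.2) ⁻¹' B).indicator 1 z := by
    intro z
    rw [← Measure.map_apply measurable_snd hB, hK, Measure.dirac_apply' _ hB]
    rfl
  rw [Measure.map_apply measurable_snd hB, Measure.bind_apply (measurable_snd hB) K.aemeasurable,
    Measure.map_map hθ measurable_snd, Measure.map_apply (hθ.comp measurable_snd) hB]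
  simp_rw [hfun]
  exact lintegral_indicator_one (hθ.comp measurable_snd hB)

variable [IsMarkovKernel K]

/-- One step of the coupling. Two finite measures `a`, `b` with the same second marginal keep a
common environment, so on the set `G`, where `K` dominates `α • κ`, they produce a common part
`c` after one step, of mass at least `α (|a| - a Gᶜ - b Gᶜ)`; what remains still has
equal second marginals. -/
lemma exists_common_part_comp (hθ : Measurable θ)
    (hK : ∀ z, (K z).map Prod.snd = Measure.dirac (θ z.2))
    {G : Set (E × T)} (hGm : MeasurableSet G) {α : ℝ} (hα : 0 ≤ α)
    {κ : Kernel T (E × T)} [IsMarkovKernel κ]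
    (hG : ∀ z ∈ G, ∀ A, MeasurableSet A → ENNReal.ofReal α * κ z.2 A ≤ K z A)
    (a b : Measure (E × T)) [IsFiniteMeasure a] [IsFiniteMeasure b]
    (hab : a.map Prod.snd = b.map Prod.snd) :
    ∃ c a' b' : Measure (E × T), IsFiniteMeasure c ∧ IsFiniteMeasure a' ∧ IsFiniteMeasure b' ∧
      K ∘ₘ a = c + a' ∧ K ∘ₘ b = c + b' ∧ a'.map Prod.snd = b'.map Prod.snd ∧
      a'.real Set.univ ≤ a.real Set.univ - α * (a.real Set.univ - a.real Gᶜ - b.real Gᶜ) := by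
  have hsplit : ∀ d : Measure (E × T), (d.restrict G).map Prod.snd + (d.restrict Gᶜ).map Prod.snd
      = d.map Prod.snd := fun d => by
    rw [← Measure.map_add _ _ measurable_snd, Measure.restrict_add_restrict_compl hGm]
  obtain ⟨m, hma, hmb, hm⟩ := exists_common_part ((a.restrict G).map Prod.snd)
    ((a.restrict Gᶜ).map Prod.snd) ((b.restrict G).map Prod.snd) ((b.restrict Gᶜ).map Prod.snd)
    (by rw [hsplit, hsplit, hab])
  have : IsFiniteMeasure m := isFiniteMeasure_of_le _ hma
  set c : Measure (E × T) := ENNReal.ofReal α • (κ ∘ₘ m) with hc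
  have : IsFiniteMeasure c := by rw [hc]; exact Measure.smul_finite _ ENNReal.ofReal_ne_top
  have hcle : ∀ d : Measure (E × T), m ≤ (d.restrict G).map Prod.snd → c ≤ K ∘ₘ d := by
    intro d hd
    refine Measure.le_iff.2 fun A hA => ?_
    calc c A = ENNReal.ofReal α * ∫⁻ y, κ y A ∂m := by
          rw [hc, Measure.smul_apply, Measure.bind_apply hA κ.aemeasurable, smul_eq_mul]
      _ ≤ ENNReal.ofReal α * ∫⁻ y, κ y A ∂((d.restrict G).map Prod.snd) := by
          gcongr
      _ = ∫⁻ z in G, ENNReal.ofReal α * κ z.2 A ∂d := by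
          rw [lintegral_map (κ.measurable_coe hA) measurable_snd]
          exact (lintegral_const_mul _ ((κ.measurable_coe hA).comp measurable_snd)).symm
      _ ≤ ∫⁻ z in G, K z A ∂d := setLIntegral_mono' hGm fun z hz => hG z hz A hA
      _ ≤ ∫⁻ z, K z A ∂d := setLIntegral_le_lintegral _ _
      _ = (K ∘ₘ d) A := (Measure.bind_apply hA K.aemeasurable).symm
  have hca := Measure.sub_add_cancel_of_le (hcle a hma)
  have hcb := Measure.sub_add_cancel_of_le (hcle b hmb)
  set a' := K ∘ₘ a - c with ha'
  set b' := K ∘ₘ b - c with hb'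
  have : IsFiniteMeasure a' := isFiniteMeasure_of_le _ Measure.sub_le
  have : IsFiniteMeasure b' := isFiniteMeasure_of_le _ Measure.sub_le
  refine ⟨c, a', b', inferInstance, inferInstance, inferInstance, by rw [add_comm, hca],
    by rw [add_comm, hcb], ?_, ?_⟩
  · have hmap : a'.map Prod.snd + c.map Prod.snd = b'.map Prod.snd + c.map Prod.snd := by
      rw [← Measure.map_add _ _ measurable_snd, ← Measure.map_add _ _ measurable_snd, hca, hcb,
        map_snd_comp_of_skew hθ hK, map_snd_comp_of_skew hθ hK, hab]
    ext B hB
    have := congrArg (fun ρ => ρ B) hmap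
    simp only [Measure.add_apply] at this
    exact (ENNReal.add_left_inj (measure_ne_top _ _)).1 this
  · have hmass : a'.real Set.univ + c.real Set.univ = a.real Set.univ := by
      rw [← measureReal_add_apply, hca, measureReal_def, measureReal_def,
        Measure.bind_apply MeasurableSet.univ K.aemeasurable]
      simp
    have hcmass : c.real Set.univ = α * m.real Set.univ := by
      rw [hc, measureReal_ennreal_smul_apply, ENNReal.toReal_ofReal hα, measureReal_def,
        Measure.bind_apply MeasurableSet.univ κ.aemeasurable]
      simp [measureReal_def]
    have hmap_univ : ∀ (d : Measure (E × T)) (H : Set (E × T)),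
        ((d.restrict H).map Prod.snd).real Set.univ = d.real H := fun d H => by
      rw [map_measureReal_apply measurable_snd MeasurableSet.univ]
      simp
    rw [hmap_univ, hmap_univ] at hm
    have hGc := measureReal_add_measureReal_compl (μ := a) hGm
    have := mul_le_mul_of_nonneg_left (show a.real Set.univ - a.real Gᶜ - b.real Gᶜ
      ≤ m.real Set.univ by linarith) hα
    linarith

/-- Quantitative merging. If both sequences of laws charge `Gᶜ` with mass at most `ε` at all
times, the uncoupled mass `p t` satisfies `p (t + 1) ≤ (1 - α) p t + 2 α ε`. -/
lemma tvDist_le_of_minorization (hθ : Measurable θ)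
    (hK : ∀ z, (K z).map Prod.snd = Measure.dirac (θ z.2))
    {G : Set (E × T)} (hGm : MeasurableSet G) {α ε : ℝ} (hα : 0 ≤ α) (hα1 : α ≤ 1)
    (hε : 0 ≤ ε) {κ : Kernel T (E × T)} [IsMarkovKernel κ]
    (hG : ∀ z ∈ G, ∀ A, MeasurableSet A → ENNReal.ofReal α * κ z.2 A ≤ K z A)
    {μ ν : ℕ → Measure (E × T)} [∀ t, IsProbabilityMeasure (μ t)]
    [∀ t, IsProbabilityMeasure (ν t)]
    (hμ : ∀ t, μ (t + 1) = K ∘ₘ μ t) (hν : ∀ t, ν (t + 1) = K ∘ₘ ν t)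
    (h0 : (μ 0).map Prod.snd = (ν 0).map Prod.snd)
    (hμG : ∀ t, (μ t).real Gᶜ ≤ ε) (hνG : ∀ t, (ν t).real Gᶜ ≤ ε) (t : ℕ) :
    tvDist (μ t) (ν t) ≤ 2 * ((1 - α) ^ t + 2 * ε) := by
  have key : ∃ c a b : Measure (E × T), IsFiniteMeasure c ∧ IsFiniteMeasure a ∧
      IsFiniteMeasure b ∧ μ t = c + a ∧ ν t = c + b ∧ a.map Prod.snd = b.map Prod.snd ∧
      a.real Set.univ ≤ (1 - α) ^ t + 2 * ε := by
    induction t with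
    | zero =>
      exact ⟨0, μ 0, ν 0, inferInstance, inferInstance, inferInstance, by simp, by simp, h0,
        by simp [hε]⟩
    | succ t ih =>
      obtain ⟨c, a, b, _, _, _, hμt, hνt, hab, hmass⟩ := ih
      obtain ⟨c', a', b', _, _, _, ha', hb', hab', hmass'⟩ :=
        exists_common_part_comp hθ hK hGm hα hG a b hab
      refine ⟨K ∘ₘ c + c', a', b', inferInstance, inferInstance, inferInstance, ?_, ?_, hab', ?_⟩
      · rw [hμ, hμt, Measure.comp_add, ha', add_assoc]
      · rw [hν, hνt, Measure.comp_add, hb', add_assoc]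
      · have ha : a.real Gᶜ ≤ ε := by
          have := hμG t
          rw [hμt, measureReal_add_apply] at this
          linarith [measureReal_nonneg (μ := c) (s := Gᶜ)]
        have hb : b.real Gᶜ ≤ ε := by
          have := hνG t
          rw [hνt, measureReal_add_apply] at this
          linarith [measureReal_nonneg (μ := c) (s := Gᶜ)]
        have h1 := mul_le_mul_of_nonneg_left ha hα
        have h2 := mul_le_mul_of_nonneg_left hb hα
        have h3 := mul_le_mul_of_nonneg_left hmass (sub_nonneg.2 hα1)
        rw [pow_succ]
        linarith
  obtain ⟨c, a, b, _, _, _, hμt, hνt, hab, hmass⟩ := key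
  have hb : b.real Set.univ = a.real Set.univ := by
    have := congrArg (fun ρ => ρ.real Set.univ) hab
    simpa [map_measureReal_apply measurable_snd MeasurableSet.univ] using this.symm
  rw [hμt, hνt]
  linarith [tvDist_add_le c a b]

lemma abs_measureReal_comp_sub_le_tvDist {Z : Type*} [MeasurableSpace Z] (K : Kernel Z Z)
    [IsMarkovKernel K] (μ ν : Measure Z) [IsFiniteMeasure μ] [IsFiniteMeasure ν] {A : Set Z}
    (hA : MeasurableSet A) : |(K ∘ₘ μ).real A - (K ∘ₘ ν).real A| ≤ tvDist μ ν := by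
  have hint : ∀ ρ : Measure Z, (K ∘ₘ ρ).real A = ∫ z, (K z).real A ∂ρ := fun ρ => by
    rw [measureReal_def, Measure.bind_apply hA K.aemeasurable]
    exact (integral_toReal (K.measurable_coe hA).aemeasurable
      (ae_of_all _ fun z => measure_lt_top _ _)).symm
  rw [hint, hint]
  exact abs_integral_sub_le_tvDist μ ν (K.measurable_coe hA).ennreal_toReal fun z => by
    rw [abs_of_nonneg measureReal_nonneg]; exact measureReal_le_one

/-- A total variation limit of the laws of a Markov chain is invariant. -/
lemma comp_eq_self_of_tendsto_tvDist {Z : Type*} [MeasurableSpace Z] {K : Kernel Z Z}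
    [IsMarkovKernel K] {μ : ℕ → Measure Z} [∀ t, IsProbabilityMeasure (μ t)]
    (hμ : ∀ t, μ (t + 1) = K ∘ₘ μ t) {ρ : Measure Z} [IsProbabilityMeasure ρ]
    (h : Tendsto (fun t => tvDist (μ t) ρ) atTop (𝓝 0)) : K ∘ₘ ρ = ρ := by
  ext A hA
  rw [← measureReal_eq_measureReal_iff, ← sub_eq_zero, ← abs_eq_zero]
  refine le_antisymm (ge_of_tendsto' (x := atTop)
    (by simpa using h.add (h.comp (tendsto_add_atTop_nat 1))) fun t => ?_) (abs_nonneg _)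
  refine (abs_sub_le _ ((μ (t + 1)).real A) _).trans (add_le_add ?_
    (abs_measureReal_sub_le_tvDist _ _ hA))
  rw [hμ, abs_sub_comm]
  exact abs_measureReal_comp_sub_le_tvDist K _ _ hA

end Contraction

/-! ### The chain together with its environment -/

section Environment

/-- The time shift of an environment. The index is written `1 + k` as in `IsStationaryLaw`. -/
def envShift {S : Type*} (y : ℤ → S) : ℤ → S := fun k => y (1 + k)

variable {E S : Type*} [MeasurableSpace E] [MeasurableSpace S]

lemma measurable_envShift : Measurable (envShift : (ℤ → S) → ℤ → S) :=
  measurable_pi_lambda _ fun _ => measurable_pi_apply _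

/-- The transition kernel of the Markov chain `(X_t, (Y_{t+k})_k)` on `E × S^ℤ`: from `(x, y)` the
first coordinate moves according to `Q(x, y_0, ·)` and the environment is shifted. -/
noncomputable def envKernel (Q : Kernel (E × S) E) :
    Kernel (E × (ℤ → S)) (E × (ℤ → S)) :=
  (Q.comap (fun z => (z.1, z.2 0)) (by fun_prop)) ×ₖ
    Kernel.deterministic (fun z => envShift z.2) (measurable_envShift.comp measurable_snd)

instance (Q : Kernel (E × S) E) [IsMarkovKernel Q] : IsMarkovKernel (envKernel Q) := by
  unfold envKernel; infer_instance

lemma envKernel_apply (Q : Kernel (E × S) E) [IsMarkovKernel Q] (z : E × (ℤ → S)) :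
    envKernel Q z = (Q (z.1, z.2 0)).prod (Measure.dirac (envShift z.2)) := by
  rw [envKernel, Kernel.prod_apply, Kernel.comap_apply, Kernel.deterministic_apply]

lemma map_snd_envKernel (Q : Kernel (E × S) E) [IsMarkovKernel Q] (z : E × (ℤ → S)) :
    (envKernel Q z).map Prod.snd = Measure.dirac (envShift z.2) := by
  rw [envKernel_apply, Measure.map_snd_prod]
  simp

/-- The step of the regenerating chain: a draw from `ν` for the first coordinate, independently
of its position, and the shifted environment. -/
noncomputable def regenKernel (ν : Measure E) : Kernel (ℤ → S) (E × (ℤ → S)) :=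
  Kernel.const _ ν ×ₖ Kernel.deterministic envShift measurable_envShift

instance (ν : Measure E) [IsProbabilityMeasure ν] :
    IsMarkovKernel (regenKernel (S := S) ν) := by
  unfold regenKernel; infer_instance

lemma mul_regenKernel_le_envKernel (Q : Kernel (E × S) E) [IsMarkovKernel Q] {ν : Measure E}
    [IsProbabilityMeasure ν] {α : ℝ} {z : E × (ℤ → S)}
    (h : ∀ A, MeasurableSet A → ENNReal.ofReal α * ν A ≤ Q (z.1, z.2 0) A)
    {A : Set (E × (ℤ → S))} (hA : MeasurableSet A) :
    ENNReal.ofReal α * regenKernel ν z.2 A ≤ envKernel Q z A := by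
  have hmeas : Measurable fun x : E => (x, envShift z.2) := by fun_prop
  have hd : ∀ ρ : Measure E, SFinite ρ →
      ρ.prod (Measure.dirac (envShift z.2)) A = ρ ((fun x => (x, envShift z.2)) ⁻¹' A) :=
    fun ρ _ => by rw [Measure.prod_dirac, Measure.map_apply hmeas hA]
  rw [envKernel_apply, regenKernel, Kernel.prod_apply, Kernel.const_apply,
    Kernel.deterministic_apply, hd _ inferInstance, hd _ inferInstance]
  exact h _ (hmeas hA)

variable {Ω : Type*} [MeasurableSpace Ω] {P : Measure Ω} {Q : Kernel (E × S) E}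
  {X : ℕ → Ω → E} {Y : ℤ → Ω → S}

lemma IsMCRE.measurable_pair (h : IsMCRE P Q X Y) (t : ℕ) :
    Measurable fun ω => (X t ω, fun k : ℤ => Y (t + k) ω) :=
  (h.measurable_chain t).prodMk (measurable_pi_lambda _ fun _ => h.measurable_env _)

lemma IsMCRE.isProbabilityMeasure_jointLaw [IsProbabilityMeasure P] (h : IsMCRE P Q X Y) (t : ℕ) :
    IsProbabilityMeasure (jointLaw P X Y t) :=
  Measure.isProbabilityMeasure_map (h.measurable_pair t).aemeasurable

/-- The defining property of the chain in random environment says that `(X_t, (Y_{t+k})_k)` moves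
by `envKernel Q`, since the shifted environment is known to the conditioning sigma-algebra. -/
lemma IsMCRE.jointLaw_succ [IsProbabilityMeasure P] [IsMarkovKernel Q] (h : IsMCRE P Q X Y)
    (t : ℕ) : jointLaw P X Y (t + 1) = envKernel Q ∘ₘ jointLaw P X Y t := by
  have := h.isProbabilityMeasure_jointLaw (t + 1)
  refine Measure.ext_prod fun {A B} hA hB => ?_
  have hle : pastSigma X Y t ≤ ‹MeasurableSpace Ω› :=
    sup_le (iSup_le fun j => (h.measurable_env j).comap_le)
      (iSup₂_le fun i _ => (h.measurable_chain i).comap_le)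
  set D : Set Ω := (fun ω (k : ℤ) => Y ((t + 1 : ℕ) + k) ω) ⁻¹' B with hD
  have hDpast : MeasurableSet[pastSigma X Y t] D := by
    have hY : ∀ j, Measurable[pastSigma X Y t] (Y j) := fun j =>
      (comap_measurable (Y j)).mono
        ((le_iSup (fun j : ℤ => MeasurableSpace.comap (Y j) inferInstance) j).trans le_sup_left)
        le_rfl
    exact (@measurable_pi_lambda Ω ℤ (fun _ => S) (pastSigma X Y t) _ _ fun _ => hY _) hB
  have hDm : MeasurableSet D := hle _ hDpast
  have hshift : ∀ ω, envShift (fun k : ℤ => Y (t + k) ω) = fun k : ℤ => Y ((t + 1 : ℕ) + k) ω := by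
    intro ω
    funext k
    simp only [envShift]
    congr 1
    push_cast
    ring
  have hXA := h.measurable_chain (t + 1) hA
  have hQm : Measurable fun ω => Q (X t ω, Y t ω) A :=
    (Q.measurable_coe hA).comp ((h.measurable_chain t).prodMk (h.measurable_env t))
  have hcond : P.real (X (t + 1) ⁻¹' A ∩ D) = ∫ ω in D, (Q (X t ω, Y t ω)).real A ∂P := by
    have h1 := setIntegral_condExp hle
      ((integrable_const (1 : ℝ)).indicator hXA : Integrable _ P) hDpast
    rw [setIntegral_congr_ae hDm ((h.condProb_eq t A hA).mono fun ω hω _ => hω),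
      integral_indicator hXA] at h1
    rw [h1]
    simp [Measure.restrict_restrict hXA]
  have hcond' : P (X (t + 1) ⁻¹' A ∩ D) = ∫⁻ ω in D, Q (X t ω, Y t ω) A ∂P := by
    rw [← ENNReal.toReal_eq_toReal_iff' (measure_ne_top _ _)]
    · rw [← integral_toReal hQm.aemeasurable (ae_of_all _ fun ω => measure_lt_top _ _)]
      exact hcond
    · refine ((lintegral_mono fun ω => prob_le_one).trans_lt ?_).ne
      simp [measure_lt_top]
  rw [jointLaw, Measure.map_apply (h.measurable_pair _) (hA.prod hB),
    Measure.bind_apply (hA.prod hB) (envKernel Q).aemeasurable, jointLaw,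
    lintegral_map ((envKernel Q).measurable_coe (hA.prod hB)) (h.measurable_pair _)]
  have hker : ∀ ω, envKernel Q (X t ω, fun k : ℤ => Y (t + k) ω) (A ×ˢ B)
      = D.indicator (fun ω => Q (X t ω, Y t ω) A) ω := by
    intro ω
    rw [envKernel_apply, Measure.prod_prod, Measure.dirac_apply' _ hB]
    simp only [hshift, add_zero]
    by_cases hω : ω ∈ D
    · rw [Set.indicator_of_mem hω, Set.indicator_of_mem (show _ ∈ B from hω)]
      simp
    · rw [Set.indicator_of_notMem hω, Set.indicator_of_notMem (show _ ∉ B from hω)]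
      simp
  simp_rw [hker]
  rw [lintegral_indicator hDm, ← hcond']
  rfl

lemma IsMCRE.map_snd_jointLaw [IsProbabilityMeasure P] [IsMarkovKernel Q] (h : IsMCRE P Q X Y)
    {π : Measure (ℤ → S)} (hπ : IsStationaryLaw π) (h0 : (jointLaw P X Y 0).map Prod.snd = π)
    (t : ℕ) : (jointLaw P X Y t).map Prod.snd = π := by
  induction t with
  | zero => exact h0
  | succ t ih =>
    rw [h.jointLaw_succ, map_snd_comp_of_skew measurable_envShift (map_snd_envKernel Q), ih]
    exact hπ 1

lemma IsMCRE.jointLaw_eq_of_zero [IsProbabilityMeasure P] [IsMarkovKernel Q]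
    (h : IsMCRE P Q X Y) {Ω' : Type*} [MeasurableSpace Ω'] {P' : Measure Ω'}
    [IsProbabilityMeasure P'] {X' : ℕ → Ω' → E} {Y' : ℤ → Ω' → S} (h' : IsMCRE P' Q X' Y')
    (h0 : jointLaw P X Y 0 = jointLaw P' X' Y' 0) (t : ℕ) :
    jointLaw P X Y t = jointLaw P' X' Y' t := by
  induction t with
  | zero => exact h0
  | succ t ih => rw [h.jointLaw_succ, h'.jointLaw_succ, ih]

/-- Membership of the initial law in `tightInitialLaws` is a statement about the realized chain:
the path-space chain in the definition has the same marginals. -/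
lemma IsMCRE.tendsto_iSup_jointLaw [IsProbabilityMeasure P] [IsMarkovKernel Q]
    (h : IsMCRE P Q X Y) {π : Measure (ℤ → S)} {Xset : ℕ → Set E}
    (hXmeas : ∀ n, MeasurableSet (Xset n)) (h0 : jointLaw P X Y 0 ∈ tightInitialLaws π Q Xset) :
    Tendsto (fun n => ⨆ t : ℕ, jointLaw P X Y t {z | z.1 ∉ Xset n}) atTop (𝓝 0) := by
  obtain ⟨_, _, R, _, hR, hR0, hlim⟩ := h0
  refine hlim.congr fun n => iSup_congr fun t => ?_
  have hmeas : MeasurableSet {z : E × (ℤ → S) | z.1 ∉ Xset n} := measurable_fst (hXmeas n).compl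
  rw [h.jointLaw_eq_of_zero hR hR0.symm, jointLaw, Measure.map_apply (hR.measurable_pair t) hmeas]
  rfl

end Environment

/-! ### Uniform merging -/

section Merging

variable {E S : Type*} [MeasurableSpace E] [MeasurableSpace S]

/-- The minorization condition at level `n`: for `x ∈ Xset n` and `y ∈ Yset n` the kernel dominates
a positive multiple of one probability measure. No monotonicity in `n` is recorded. -/
def IsMinorized (Q : Kernel (E × S) E) (Xset : ℕ → Set E) (Yset : ℕ → Set S) (n : ℕ) : Prop :=
  ∃ (α : ℝ) (ν : Measure E), 0 < α ∧ α ≤ 1 ∧ IsProbabilityMeasure ν ∧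
    ∀ y ∈ Yset n, ∀ x ∈ Xset n, ∀ A : Set E, MeasurableSet A →
      ENNReal.ofReal α * ν A ≤ Q (x, y) A

/-- Two sequences of laws driven by `envKernel Q` merge, at a rate that does not change when one
of them is delayed by a time `s`: the tightness bounds hold for all times at once. -/
lemma exists_forall_tvDist_le {Q : Kernel (E × S) E} [IsMarkovKernel Q]
    {π : Measure (ℤ → S)} {Xset : ℕ → Set E} (hXmeas : ∀ n, MeasurableSet (Xset n))
    {Yset : ℕ → Set S} (hYmeas : ∀ n, MeasurableSet (Yset n))
    (hYtight : Tendsto (fun n => π {y | y 0 ∉ Yset n}) atTop (𝓝 0))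
    (hminor : ∀ n, IsMinorized Q Xset Yset n)
    {μ ν : ℕ → Measure (E × (ℤ → S))} [∀ t, IsProbabilityMeasure (μ t)]
    [∀ t, IsProbabilityMeasure (ν t)]
    (hμ : ∀ t, μ (t + 1) = envKernel Q ∘ₘ μ t) (hν : ∀ t, ν (t + 1) = envKernel Q ∘ₘ ν t)
    (hμπ : ∀ t, (μ t).map Prod.snd = π) (hνπ : ∀ t, (ν t).map Prod.snd = π)
    (hμX : Tendsto (fun n => ⨆ t : ℕ, μ t {z | z.1 ∉ Xset n}) atTop (𝓝 0))
    (hνX : Tendsto (fun n => ⨆ t : ℕ, ν t {z | z.1 ∉ Xset n}) atTop (𝓝 0))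
    {δ : ℝ} (hδ : 0 < δ) : ∃ T, ∀ t ≥ T, ∀ s, tvDist (μ t) (ν (t + s)) ≤ δ := by
  -- The two ways of leaving `G` cost `δ / 16` each, and `2 * (δ / 4 + 2 * (δ / 8)) = δ`.
  have hpos : (0 : ENNReal) < ENNReal.ofReal (δ / 16) := ENNReal.ofReal_pos.2 (by positivity)
  obtain ⟨n, ⟨hY, hX⟩, hX'⟩ := (((hYtight.eventually_le_const hpos).and
    (hμX.eventually_le_const hpos)).and (hνX.eventually_le_const hpos)).exists
  obtain ⟨α, β, hα, hα1, _, hQ⟩ := hminor n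
  let G : Set (E × (ℤ → S)) := {z | z.1 ∈ Xset n ∧ z.2 0 ∈ Yset n}
  have hGm : MeasurableSet G := (measurable_fst (hXmeas n)).inter
    (((measurable_pi_apply 0).comp measurable_snd) (hYmeas n))
  have hbad : ∀ ρ : ℕ → Measure (E × (ℤ → S)), (∀ t, (ρ t).map Prod.snd = π) →
      (⨆ t : ℕ, ρ t {z | z.1 ∉ Xset n}) ≤ ENNReal.ofReal (δ / 16) →
      ∀ t, (ρ t).real Gᶜ ≤ δ / 8 := by
    intro ρ hρπ hρX t
    have hYm : MeasurableSet {y : ℤ → S | y 0 ∉ Yset n} :=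
      (measurable_pi_apply (0 : ℤ) : Measurable fun y : ℤ → S => y 0) (hYmeas n).compl
    have hsub : Gᶜ ⊆ {z | z.1 ∉ Xset n} ∪ Prod.snd ⁻¹' {y : ℤ → S | y 0 ∉ Yset n} := by
      intro z hz
      by_cases hx : z.1 ∈ Xset n
      · exact Or.inr fun hy => hz ⟨hx, hy⟩
      · exact Or.inl hx
    refine ENNReal.toReal_le_of_le_ofReal (by positivity) ?_
    calc ρ t Gᶜ ≤ ρ t {z | z.1 ∉ Xset n} + ρ t (Prod.snd ⁻¹' {y : ℤ → S | y 0 ∉ Yset n}) :=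
          (measure_mono hsub).trans (measure_union_le _ _)
      _ ≤ ENNReal.ofReal (δ / 16) + ENNReal.ofReal (δ / 16) := by
          refine add_le_add ((le_iSup (fun t => ρ t {z | z.1 ∉ Xset n}) t).trans hρX) ?_
          rw [← Measure.map_apply measurable_snd hYm, hρπ]
          exact hY
      _ = ENNReal.ofReal (δ / 8) := by
          rw [← ENNReal.ofReal_add (by positivity) (by positivity)]
          congr 1
          ring
  have hμG := hbad μ hμπ hX
  have hνG := hbad ν hνπ hX'
  obtain ⟨T, hT⟩ := exists_pow_lt_of_lt_one (show 0 < δ / 4 by positivity)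
    (show 1 - α < 1 by linarith)
  refine ⟨T, fun t ht s => ?_⟩
  have hmerge := tvDist_le_of_minorization measurable_envShift (map_snd_envKernel Q) hGm hα.le hα1
    (show 0 ≤ δ / 8 by positivity) (κ := regenKernel β)
    (fun z hz A hA => mul_regenKernel_le_envKernel Q (hQ _ hz.2 _ hz.1) hA)
    (μ := μ) (ν := fun t => ν (t + s)) hμ
    (fun t => by rw [← hν]; congr 1; ring) (by rw [hμπ, hνπ]) hμG (fun t => hνG _) t
  have hpow : (1 - α) ^ t ≤ (1 - α) ^ T :=
    pow_le_pow_of_le_one (by linarith) (by linarith) ht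
  linarith

lemma IsMCRE.exists_forall_tvDist_jointLaw_le {Q : Kernel (E × S) E} [IsMarkovKernel Q]
    {π : Measure (ℤ → S)} (hπ : IsStationaryLaw π)
    {Xset : ℕ → Set E} (hXmeas : ∀ n, MeasurableSet (Xset n))
    {Yset : ℕ → Set S} (hYmeas : ∀ n, MeasurableSet (Yset n))
    (hYtight : Tendsto (fun n => π {y | y 0 ∉ Yset n}) atTop (𝓝 0))
    (hminor : ∀ n, IsMinorized Q Xset Yset n)
    {Ω Ω' : Type*} [MeasurableSpace Ω] [MeasurableSpace Ω']
    {P : Measure Ω} [IsProbabilityMeasure P] {P' : Measure Ω'} [IsProbabilityMeasure P']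
    {X : ℕ → Ω → E} {Y : ℤ → Ω → S} {X' : ℕ → Ω' → E} {Y' : ℤ → Ω' → S}
    (h : IsMCRE P Q X Y) (h' : IsMCRE P' Q X' Y')
    (h0 : jointLaw P X Y 0 ∈ tightInitialLaws π Q Xset)
    (h0' : jointLaw P' X' Y' 0 ∈ tightInitialLaws π Q Xset) {δ : ℝ} (hδ : 0 < δ) :
    ∃ T, ∀ t ≥ T, ∀ s, tvDist (jointLaw P X Y t) (jointLaw P' X' Y' (t + s)) ≤ δ := by
  have := h.isProbabilityMeasure_jointLaw
  have := h'.isProbabilityMeasure_jointLaw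
  exact exists_forall_tvDist_le hXmeas hYmeas hYtight hminor h.jointLaw_succ h'.jointLaw_succ
    (h.map_snd_jointLaw hπ h0.2.1) (h'.map_snd_jointLaw hπ h0'.2.1)
    (h.tendsto_iSup_jointLaw hXmeas h0) (h'.tendsto_iSup_jointLaw hXmeas h0') hδ

end Merging

/-! ### Convergence to the invariant law -/

theorem theorem2 {E S : Type*}
    [TopologicalSpace E] [PolishSpace E] [MeasurableSpace E] [BorelSpace E]
    [TopologicalSpace S] [PolishSpace S] [MeasurableSpace S] [BorelSpace S]
    -- the law of the stationary environment
    (π : Measure (ℤ → S)) [IsProbabilityMeasure π] (hπ : IsStationaryLaw π)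
    (Q : Kernel (E × S) E) [IsMarkovKernel Q]
    -- the non-decreasing sequences of measurable sets
    (Xset : ℕ → Set E) (hXmono : Monotone Xset) (hXmeas : ∀ n, MeasurableSet (Xset n))
    (hX0 : (Xset 0).Nonempty)
    (Yset : ℕ → Set S) (hYmono : Monotone Yset) (hYmeas : ∀ n, MeasurableSet (Yset n))
    (hY0 : (Yset 0).Nonempty)
    (hYtight : Tendsto (fun n => π {y | y 0 ∉ Yset n}) atTop (𝓝 0))
    -- the minorization condition
    (hminor : ∃ (α : ℕ → ℝ) (ν : ℕ → Measure E), Antitone α ∧ (∀ n, 0 < α n ∧ α n ≤ 1) ∧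
      (∀ n, IsProbabilityMeasure (ν n)) ∧
      ∀ n, ∀ y ∈ Yset n, ∀ x ∈ Xset n, ∀ A : Set E, MeasurableSet A →
        ENNReal.ofReal (α n) * ν n A ≤ Q (x, y) A)
    (hMb : (tightInitialLaws π Q Xset).Nonempty) :
    ∃ μs : Measure (E × (ℤ → S)), IsProbabilityMeasure μs ∧
      -- convergence in total variation, with a limit that does not depend on the initial law
      (∀ {Ω : Type*} [MeasurableSpace Ω] (P : Measure Ω) [IsProbabilityMeasure P]
        (X : ℕ → Ω → E) (Y : ℤ → Ω → S), IsMCRE P Q X Y →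
        jointLaw P X Y 0 ∈ tightInitialLaws π Q Xset →
        Tendsto (fun t => tvDist (jointLaw P X Y t) μs) atTop (𝓝 0)) ∧
      -- two chains with initial laws in the class merge
      (∀ {Ω Ω' : Type*} [MeasurableSpace Ω] [MeasurableSpace Ω']
        (P : Measure Ω) [IsProbabilityMeasure P] (P' : Measure Ω') [IsProbabilityMeasure P']
        (X : ℕ → Ω → E) (Y : ℤ → Ω → S) (X' : ℕ → Ω' → E) (Y' : ℤ → Ω' → S),
        IsMCRE P Q X Y → IsMCRE P' Q X' Y' →
        jointLaw P X Y 0 ∈ tightInitialLaws π Q Xset →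
        jointLaw P' X' Y' 0 ∈ tightInitialLaws π Q Xset →
        Tendsto (fun t => tvDist (jointLaw P X Y t) (jointLaw P' X' Y' t)) atTop (𝓝 0)) ∧
      -- invariance of the limit
      (∀ {Ω : Type*} [MeasurableSpace Ω] (P : Measure Ω) [IsProbabilityMeasure P]
        (X : ℕ → Ω → E) (Y : ℤ → Ω → S), IsMCRE P Q X Y →
        jointLaw P X Y 0 = μs → ∀ t, jointLaw P X Y t = μs) := by
  have hminor' : ∀ n, IsMinorized Q Xset Yset n := by
    obtain ⟨α, ν, _, hα, hν, hQ⟩ := hminor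
    exact fun n => ⟨α n, ν n, (hα n).1, (hα n).2, hν n, hQ n⟩
  -- The laws of the path-space chain from some admissible initial law form a Cauchy sequence.
  obtain ⟨μ, hμ⟩ := hMb
  obtain ⟨_, _, R, _, hR, hR0, _⟩ := id hμ
  rw [← hR0] at hμ
  have hRprob := hR.isProbabilityMeasure_jointLaw
  obtain ⟨μs, hμs, hlim⟩ := exists_tendsto_tvDist_of_cauchy
    (jointLaw R (fun t ω => ω.1 t) (fun k ω => ω.2 k)) fun _ hδ =>
      hR.exists_forall_tvDist_jointLaw_le hπ hXmeas hYmeas hYtight hminor' hR hμ hμ hδ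
  refine ⟨μs, hμs, ?_, ?_, ?_⟩
  · intro Ω _ P _ X Y h h0
    have := h.isProbabilityMeasure_jointLaw
    refine squeeze_zero (fun t => tvDist_nonneg _ _)
      (fun t => tvDist_triangle _ (jointLaw R (fun t ω => ω.1 t) (fun k ω => ω.2 k) t) _) ?_
    simpa using (tendsto_tvDist_of_exists_le fun _ hδ =>
      h.exists_forall_tvDist_jointLaw_le hπ hXmeas hYmeas hYtight hminor' hR h0 hμ hδ).add hlim
  · intro Ω Ω' _ _ P _ P' _ X Y X' Y' h h' h0 h0'
    exact tendsto_tvDist_of_exists_le fun _ hδ =>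
      h.exists_forall_tvDist_jointLaw_le hπ hXmeas hYmeas hYtight hminor' h' h0 h0' hδ
  · intro Ω _ P _ X Y h h0 t
    induction t with
    | zero => exact h0
    | succ t ih => rw [h.jointLaw_succ, ih, comp_eq_self_of_tendsto_tvDist hR.jointLaw_succ hlim]
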